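/- Let $d,N\ge 1$ and let $\Omega\subset\mathbb R^d$ be compact with Lebesgue measure $|\Omega|\ge 1$. Let $K$ be the set of absolutely continuous probability measures on $\Omega$ whose density is at most $1$ almost everywhere. For $X=(x_1,\dots,x_N)\in(\mathbb R^d)^N$ put $\mu_X=\frac1N\sum_{i=1}^N\delta_{x_i}$, and for $\psi\in\mathbb R^N$ let $$L_i(\psi)=\{x\in\Omega \mid \forall j,\ \|x-x_i\|^2-\psi_i\le\|x-x_j\|^2-\psi_j\}.$$ Let $B(x,r)$ denote the closed ball of centre $x$ and radius $r$. Let $W_2^2(\rho,\mu)$ be the infimum of $\int\|x-y\|^2\,d\pi(x,y)$ over all couplings $\pi$ of $\rho$ and $\mu$. Suppose that the points $x_1,\dots,x_N$ are pairwise distinct. Then there exists $\psi\in\mathbb R^N$ with $\psi_i\ge 0$ for all $i$ and $$|L_i(\psi)\cap\Omega\cap B(x_i,\sqrt{\psi_i})|=\frac1N\qquad\text{for all } i.\qquad(*)$$ Moreover, for every $\psi\in\mathbb R^N$ with nonnegative entries satisfying $(*)$, set $$\varphi(x)=\min\Big(\min_i\big(\|x-x_i\|^2-\psi_i\big),\,0\Big)\quad(x\in\mathbb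 R^d),\qquad \sigma=\mathbf 1_{\{\varphi<0\}\cap\Omega},$$ and write $\sigma$ also for the measure with Lebesgue density $\sigma$. Then: (a) $\sigma\in K$, and $\sigma$ is the Wasserstein projection of $\mu_X$ onto $K$, that is, the unique minimizer of $\rho\mapsto W_2^2(\rho,\mu_X)$ over $\rho\in K$; (b) $\varphi\le 0$ on $\mathbb R^d$, and $\varphi(1-\sigma)=0$ on $\Omega$; (c) $(\varphi,\psi)$ is a pair of optimal Kantorovich potentials in the transport from $\sigma$ to $\mu_X$: $\varphi$ is $\sigma$-integrable and $\varphi(x)+\psi_i\le\|x-x_i\|^2$ for all $x\in\Omega$ and all $i$; the pair $(\varphi,\psi)$ maximizes $\int f\,d\sigma+\frac1N\sum_i g_i$ among all pairs $(f,g)$ of a $\sigma$-integrable $f:\mathbb R^d\to\mathbb R$ and $g\in\mathbb R^N$ with $f(x)+g_i\le\|x-x_i\|^2$ for all $x\in\Omega$ and all $i$; and $\int\varphi\,d\sigma+\frac1N\sum_i\psi_i=W_2^2(\sigma,\mu_X)<\infty$. -/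

import Mathlib

open MeasureTheory
open scoped ENNReal

namespace CrowdMotion

noncomputable section

/-- The set `D_N` of configurations of `N` points of `ℝ^d` in which two points coincide. -/
def collisionSet (d N : ℕ) : Set (Fin N → EuclideanSpace ℝ (Fin d)) :=
  {X | ∃ i j, i ≠ j ∧ X i = X j}

/-- The empirical measure `μ_X = (1/N) ∑ i, δ_{x_i}`. -/
def empiricalMeasure {d N : ℕ} (X : Fin N → EuclideanSpace ℝ (Fin d)) :
    Measure (EuclideanSpace ℝ (Fin d)) :=
  (N : ℝ≥0∞)⁻¹ • ∑ i, Measure.dirac (X i)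

/-- Transport plans (couplings) between `μ` and `ν`. -/
def transportPlans {d : ℕ} (μ ν : Measure (EuclideanSpace ℝ (Fin d))) :
    Set (Measure (EuclideanSpace ℝ (Fin d) × EuclideanSpace ℝ (Fin d))) :=
  {π | π.map Prod.fst = μ ∧ π.map Prod.snd = ν}

/-- The squared Wasserstein distance `W_2²(μ, ν)`, as an extended nonnegative number. -/
def wassersteinSq {d : ℕ} (μ ν : Measure (EuclideanSpace ℝ (Fin d))) : ℝ≥0∞ :=
  ⨅ π ∈ transportPlans μ ν, ∫⁻ p, ‖p.1 - p.2‖ₑ ^ 2 ∂π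

/-- Absolutely continuous probability measures on `Ω`, seen as measures on `ℝ^d`
concentrated on `Ω`. -/
def probAC {d : ℕ} (Ω : Set (EuclideanSpace ℝ (Fin d))) :
    Set (Measure (EuclideanSpace ℝ (Fin d))) :=
  {ρ | IsProbabilityMeasure ρ ∧ ρ Ωᶜ = 0 ∧ ρ ≪ volume}

/-- The constraint set `K`: absolutely continuous probability measures on `Ω` whose density is
at most `1`. -/
def densityConstraint {d : ℕ} (Ω : Set (EuclideanSpace ℝ (Fin d))) :
    Set (Measure (EuclideanSpace ℝ (Fin d))) :=
  {ρ | ρ ∈ probAC Ω ∧ ∀ᵐ y, ρ.rnDeriv volume y ≤ 1}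

/-- `ρ` minimizes `W_2²(·, μ)` over the set `K`. -/
def IsWassersteinProjection {d : ℕ} (K : Set (Measure (EuclideanSpace ℝ (Fin d))))
    (μ ρ : Measure (EuclideanSpace ℝ (Fin d))) : Prop :=
  ρ ∈ K ∧ ∀ ρ' ∈ K, wassersteinSq ρ μ ≤ wassersteinSq ρ' μ

/-- The Laguerre cell `L_i(ψ)` of the point `x_i` with respect to `Ω`. -/
def laguerreCell {d N : ℕ} (Ω : Set (EuclideanSpace ℝ (Fin d)))
    (X : Fin N → EuclideanSpace ℝ (Fin d)) (ψ : Fin N → ℝ) (i : Fin N) :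
    Set (EuclideanSpace ℝ (Fin d)) :=
  {y | y ∈ Ω ∧ ∀ j, ‖y - X i‖ ^ 2 - ψ i ≤ ‖y - X j‖ ^ 2 - ψ j}

/-- Every truncated cell `L_i(ψ) ∩ Ω ∩ B(x_i, √ψ_i)` has Lebesgue measure `1/N`. -/
def BalancedCells {d N : ℕ} (Ω : Set (EuclideanSpace ℝ (Fin d)))
    (X : Fin N → EuclideanSpace ℝ (Fin d)) (ψ : Fin N → ℝ) : Prop :=
  ∀ i, volume (laguerreCell Ω X ψ i ∩ Ω ∩ Metric.closedBall (X i) (Real.sqrt (ψ i)))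
    = (N : ℝ≥0∞)⁻¹

/-- The function `φ = min (min_i ‖· - x_i‖² - ψ_i, 0)`; the infimum is a minimum for `N ≥ 1`. -/
def phi {d N : ℕ} (X : Fin N → EuclideanSpace ℝ (Fin d)) (ψ : Fin N → ℝ)
    (y : EuclideanSpace ℝ (Fin d)) : ℝ :=
  min (⨅ i, (‖y - X i‖ ^ 2 - ψ i)) 0

/-- The density `σ`, i.e. the indicator function of `{φ < 0} ∩ Ω`. -/
def sigma {d N : ℕ} (Ω : Set (EuclideanSpace ℝ (Fin d)))
    (X : Fin N → EuclideanSpace ℝ (Fin d)) (ψ : Fin N → ℝ) :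
    EuclideanSpace ℝ (Fin d) → ℝ :=
  Set.indicator ({y | phi X ψ y < 0} ∩ Ω) (fun _ => 1)

/-- The measure with Lebesgue density `σ`. -/
def sigmaMeasure {d N : ℕ} (Ω : Set (EuclideanSpace ℝ (Fin d)))
    (X : Fin N → EuclideanSpace ℝ (Fin d)) (ψ : Fin N → ℝ) :
    Measure (EuclideanSpace ℝ (Fin d)) :=
  volume.withDensity (fun y => ENNReal.ofReal (sigma Ω X ψ y))

/-- `(f, g)` is admissible in the dual of the transport problem from `ρ` (concentrated on `Ω`) to
`μ_X` for the cost `‖x - y‖²`; a potential on the target side is a vector `g ∈ ℝ^N`, where `g i`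
is its value at the point `x_i`. -/
def IsAdmissiblePair {d N : ℕ} (Ω : Set (EuclideanSpace ℝ (Fin d)))
    (ρ : Measure (EuclideanSpace ℝ (Fin d))) (X : Fin N → EuclideanSpace ℝ (Fin d))
    (f : EuclideanSpace ℝ (Fin d) → ℝ) (g : Fin N → ℝ) : Prop :=
  Integrable f ρ ∧ ∀ y ∈ Ω, ∀ i, f y + g i ≤ ‖y - X i‖ ^ 2

/-- The Kantorovich dual functional `∫ f dρ + ∫ g dμ_X = ∫ f dρ + (1/N) ∑ i, g_i`. -/
def dualValue {d N : ℕ} (ρ : Measure (EuclideanSpace ℝ (Fin d)))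
    (f : EuclideanSpace ℝ (Fin d) → ℝ) (g : Fin N → ℝ) : ℝ :=
  (∫ y, f y ∂ρ) + (∑ i, g i) / (N : ℝ)

/-- `(f, g)` is a pair of optimal Kantorovich potentials in the transport from `ρ` to `μ_X`: it is
admissible, maximizes the dual functional among admissible pairs, and its dual value is the
(finite) transport cost `W_2²(ρ, μ_X)`. -/
def AreOptimalPotentials {d N : ℕ} (Ω : Set (EuclideanSpace ℝ (Fin d)))
    (ρ : Measure (EuclideanSpace ℝ (Fin d))) (X : Fin N → EuclideanSpace ℝ (Fin d))
    (f : EuclideanSpace ℝ (Fin d) → ℝ) (g : Fin N → ℝ) : Prop :=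
  IsAdmissiblePair Ω ρ X f g ∧
  (∀ f' g', IsAdmissiblePair Ω ρ X f' g' → dualValue ρ f' g' ≤ dualValue ρ f g) ∧
  wassersteinSq ρ (empiricalMeasure X) ≠ ∞ ∧
  dualValue ρ f g = (wassersteinSq ρ (empiricalMeasure X)).toReal

end

end CrowdMotion

/-!
Everything rests on the truncated cells `V_i(ψ)`, the part of `Ω` where `‖y - x_i‖² ≤ ψ_i` and
`‖y - x_i‖² - ψ_i` is minimal among the indices. Spheres are Lebesgue null, and so are the
hyperplanes separating two cells, because the points are distinct; hence `ψ ↦ |V_i(ψ)|` is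
continuous (`continuous_measure_truncatedCell`).

Existence of balancing weights (`exists_balancedCells`). Let `M` bound all squared distances from
`Ω` to the points. Among weights in `[0, M]` with all cell volumes at most `1/N` take one with
maximal sum. If `ψ_i < M` and `|V_i| < 1/N`, raising `ψ_i` a little keeps the constraints, since the
other cells shrink; so every index satisfies `|V_i| = 1/N` or `ψ_i = M`. In the presence of an index
with `ψ_i = M` the cells cover `Ω`, whose volume is at least `1`, and again all volumes are `1/N`.

Optimality. Up to null sets `{φ < 0} ∩ Ω` is the disjoint union of the cells, so `σ` has mass `1`.
On `V_i` one has `φ + ψ_i = ‖· - x_i‖²`, so sending each cell to its centre costs exactly the dual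
value of `(φ, ψ)` (`lintegral_cellPlan`), and weak duality (`ofReal_dualValue_le_wassersteinSq`)
makes both the plan and the potentials optimal. For another `ρ` in the constraint set the same pair
gives `W₂²(ρ, μ_X) ≥ ∫ φ dρ + (1/N) ∑ ψ_i`, and by the bathtub principle
(`integral_phi_sigmaMeasure_le`) `∫ φ dρ ≥ ∫ φ dσ`, with equality only for `ρ = σ`.
-/

open Filter Topology CrowdMotion

namespace CrowdMotion

/-! ### Null level sets -/

lemma measure_sq_dist_eq_null {d : ℕ} (hd : 0 < d) (a : EuclideanSpace ℝ (Fin d)) (t : ℝ) :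
    volume {y : EuclideanSpace ℝ (Fin d) | ‖y - a‖ ^ 2 = t} = 0 := by
  have : Nonempty (Fin d) := ⟨⟨0, hd⟩⟩
  refine measure_mono_null (t := Metric.sphere a (Real.sqrt t)) ?_ (Measure.addHaar_sphere _ _ _)
  intro y hy
  rw [Set.mem_ofPred_eq] at hy
  rw [mem_sphere_iff_norm, ← hy, Real.sqrt_sq (norm_nonneg _)]

/-- The interface between two Laguerre cells with distinct centres is contained in a hyperplane
orthogonal to the difference of the centres. -/
lemma measure_sq_dist_sub_eq_null {d : ℕ} {a b : EuclideanSpace ℝ (Fin d)} (hab : a ≠ b) (t : ℝ) :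
    volume {y : EuclideanSpace ℝ (Fin d) | ‖y - a‖ ^ 2 - ‖y - b‖ ^ 2 = t} = 0 := by
  set S := {y : EuclideanSpace ℝ (Fin d) | ‖y - a‖ ^ 2 - ‖y - b‖ ^ 2 = t} with hS
  rcases S.eq_empty_or_nonempty with h | ⟨z, hz⟩
  · simp [h]
  let H : Submodule ℝ (EuclideanSpace ℝ (Fin d)) := (innerSL ℝ (b - a)).ker
  have hH : H ≠ ⊤ := by
    intro h
    have : b - a ∈ H := h ▸ Submodule.mem_top
    simp only [H, LinearMap.mem_ker] at this
    have h0 : inner ℝ (b - a) (b - a) = 0 := this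
    rw [inner_self_eq_zero, sub_eq_zero] at h0
    exact hab h0.symm
  have hnull := Measure.addHaar_submodule (volume : Measure (EuclideanSpace ℝ (Fin d))) H hH
  have htrans := measure_preimage_add_right (volume : Measure (EuclideanSpace ℝ (Fin d))) (-z)
    (H : Set (EuclideanSpace ℝ (Fin d)))
  rw [hnull] at htrans
  refine measure_mono_null ?_ htrans
  intro y hy
  have hy' : ‖y - a‖ ^ 2 - ‖y - b‖ ^ 2 = t := hy
  have hz' : ‖z - a‖ ^ 2 - ‖z - b‖ ^ 2 = t := hz
  have : inner ℝ (b - a) (y + -z) = 0 := by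
    rw [← sub_eq_add_neg]
    rw [norm_sub_sq_real, norm_sub_sq_real] at hy' hz'
    rw [inner_sub_left, inner_sub_right, inner_sub_right, real_inner_comm y b, real_inner_comm z b,
      real_inner_comm y a, real_inner_comm z a]
    linarith
  exact this

/-! ### Truncated cells -/

/-- The part of the Laguerre cell of `x_i` lying in the ball of squared radius `ψ_i`. The ball is
written as `‖y - x_i‖² ≤ ψ_i`, so the set is empty when `ψ_i < 0`; this makes its volume continuous
in `ψ` on the whole space. -/
def truncatedCell {d N : ℕ} (Ω : Set (EuclideanSpace ℝ (Fin d)))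
    (X : Fin N → EuclideanSpace ℝ (Fin d)) (ψ : Fin N → ℝ) (i : Fin N) :
    Set (EuclideanSpace ℝ (Fin d)) :=
  {y | y ∈ Ω ∧ ‖y - X i‖ ^ 2 ≤ ψ i ∧ ∀ j, ‖y - X i‖ ^ 2 - ψ i ≤ ‖y - X j‖ ^ 2 - ψ j}

section

variable {d N : ℕ} {Ω : Set (EuclideanSpace ℝ (Fin d))} {X : Fin N → EuclideanSpace ℝ (Fin d)}

lemma injective_of_notMem_collisionSet (hX : X ∉ collisionSet d N) : Function.Injective X := by
  intro i j h
  by_contra hij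
  exact hX ⟨i, j, hij, h⟩

lemma truncatedCell_eq {ψ : Fin N → ℝ} {i : Fin N} (hψ : 0 ≤ ψ i) :
    laguerreCell Ω X ψ i ∩ Ω ∩ Metric.closedBall (X i) (Real.sqrt (ψ i))
      = truncatedCell Ω X ψ i := by
  ext y
  simp only [laguerreCell, truncatedCell, Set.mem_inter_iff, Set.mem_ofPred_eq,
    mem_closedBall_iff_norm, ← Real.sqrt_le_sqrt_iff hψ, Real.sqrt_sq (norm_nonneg _)]
  tauto

lemma isClosed_truncatedCell (hΩ : IsClosed Ω) (ψ : Fin N → ℝ) (i : Fin N) :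
    IsClosed (truncatedCell Ω X ψ i) := by
  have hball : IsClosed {y | ‖y - X i‖ ^ 2 ≤ ψ i} := isClosed_le (by fun_prop) (by fun_prop)
  refine hΩ.inter (hball.inter ?_)
  show IsClosed {y | ∀ j, ‖y - X i‖ ^ 2 - ψ i ≤ ‖y - X j‖ ^ 2 - ψ j}
  simp only [Set.ofPred_forall]
  exact isClosed_iInter fun j => isClosed_le (by fun_prop) (by fun_prop)

lemma aedisjoint_truncatedCell (hX : Function.Injective X) (ψ : Fin N → ℝ) :
    Pairwise (Function.onFun (AEDisjoint volume) (truncatedCell Ω X ψ)) := by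
  intro i j hij
  refine measure_mono_null ?_ (measure_sq_dist_sub_eq_null (hX.ne hij) (ψ i - ψ j))
  rintro y ⟨⟨-, -, h1⟩, -, -, h2⟩
  have := h1 j
  have := h2 i
  show _ = _
  linarith

lemma eventually_le_iff_of_ne {α : Type*} [TopologicalSpace α] {f g : α → ℝ} {a : α}
    (hf : ContinuousAt f a) (hg : ContinuousAt g a) (h : f a ≠ g a) :
    ∀ᶠ x in 𝓝 a, (f x ≤ g x ↔ f a ≤ g a) := by
  rcases lt_or_gt_of_ne h with h | h
  · filter_upwards [hf.eventually_lt hg h] with x hx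
    exact ⟨fun _ => h.le, fun _ => hx.le⟩
  · filter_upwards [hg.eventually_lt hf h] with x hx
    exact ⟨fun h' => absurd h' hx.not_ge, fun h' => absurd h' h.not_ge⟩

/-- The volume of a truncated cell depends continuously on the weights, since for every fixed `ψ`
almost no point lies on the sphere or on the hyperplanes that bound the cell. -/
lemma continuous_measure_truncatedCell (hd : 0 < d) (hΩ : IsCompact Ω) (hX : Function.Injective X)
    (i : Fin N) : Continuous fun ψ : Fin N → ℝ => volume (truncatedCell Ω X ψ i) := by
  rw [continuous_iff_continuousAt]
  intro ψ₀
  refine tendsto_measure_of_ae_tendsto_indicator _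
    (isClosed_truncatedCell hΩ.isClosed _ _).measurableSet
    (fun ψ => (isClosed_truncatedCell hΩ.isClosed _ _).measurableSet) hΩ.measurableSet
    hΩ.measure_lt_top.ne (Eventually.of_forall fun ψ y hy => hy.1) ?_
  have h1 : ∀ᵐ y : EuclideanSpace ℝ (Fin d), ‖y - X i‖ ^ 2 ≠ ψ₀ i := by
    rw [ae_iff]
    simpa using measure_sq_dist_eq_null hd (X i) (ψ₀ i)
  have h2 : ∀ j, ∀ᵐ y : EuclideanSpace ℝ (Fin d),
      j ≠ i → ‖y - X i‖ ^ 2 - ψ₀ i ≠ ‖y - X j‖ ^ 2 - ψ₀ j := by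
    intro j
    rcases eq_or_ne j i with rfl | hj
    · simp
    · rw [ae_iff]
      refine measure_mono_null ?_ (measure_sq_dist_sub_eq_null (hX.ne hj.symm) (ψ₀ i - ψ₀ j))
      intro y hy
      simp only [ne_eq, hj, not_false_eq_true, forall_const, not_not, Set.mem_ofPred_eq] at hy ⊢
      linarith
  filter_upwards [h1, ae_all_iff.2 h2] with y hy1 hy2
  have e1 : ∀ᶠ ψ in 𝓝 ψ₀, (‖y - X i‖ ^ 2 ≤ ψ i ↔ ‖y - X i‖ ^ 2 ≤ ψ₀ i) :=
    eventually_le_iff_of_ne (f := fun _ : Fin N → ℝ => ‖y - X i‖ ^ 2) (g := fun ψ => ψ i)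
      continuousAt_const (continuous_apply i).continuousAt hy1
  have e2 : ∀ᶠ ψ in 𝓝 ψ₀, ∀ j, (‖y - X i‖ ^ 2 - ψ i ≤ ‖y - X j‖ ^ 2 - ψ j ↔
      ‖y - X i‖ ^ 2 - ψ₀ i ≤ ‖y - X j‖ ^ 2 - ψ₀ j) := by
    rw [eventually_all]
    intro j
    rcases eq_or_ne j i with rfl | hj
    · simp
    · exact eventually_le_iff_of_ne (f := fun ψ : Fin N → ℝ => ‖y - X i‖ ^ 2 - ψ i)
        (g := fun ψ => ‖y - X j‖ ^ 2 - ψ j) (Continuous.continuousAt (by fun_prop))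
        (Continuous.continuousAt (by fun_prop)) (hy2 j hj)
  filter_upwards [e1, e2] with ψ k1 k2
  simp only [truncatedCell, Set.mem_ofPred_eq, k1, k2]

/-- A point covered by one of the balls lies in the truncated cell of an index minimizing
`‖y - x_i‖² - ψ_i`. -/
lemma mem_iUnion_truncatedCell {ψ : Fin N → ℝ} {y : EuclideanSpace ℝ (Fin d)} (hy : y ∈ Ω)
    {j : Fin N} (hj : ‖y - X j‖ ^ 2 ≤ ψ j) : y ∈ ⋃ i, truncatedCell Ω X ψ i := by
  have : Nonempty (Fin N) := ⟨j⟩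
  obtain ⟨i, hi⟩ := Finite.exists_min fun i => ‖y - X i‖ ^ 2 - ψ i
  refine Set.mem_iUnion.2 ⟨i, hy, ?_, hi⟩
  have := hi j
  linarith

lemma truncatedCell_update_subset {ψ : Fin N → ℝ} {i j : Fin N} (hij : j ≠ i) {t : ℝ}
    (ht : ψ i ≤ t) :
    truncatedCell Ω X (Function.update ψ i t) j ⊆ truncatedCell Ω X ψ j := by
  rintro y ⟨h1, h2, h3⟩
  rw [Function.update_of_ne hij] at h2
  refine ⟨h1, h2, fun k => ?_⟩
  have := h3 k
  rw [Function.update_of_ne hij] at this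
  rcases eq_or_ne k i with rfl | hk
  · rw [Function.update_self] at this
    linarith
  · rwa [Function.update_of_ne hk] at this

/-! ### Existence of balancing weights -/

/-- Balancing weights are found by maximizing `∑ ψ_i` over weights in `[0, M]` whose truncated
cells all have volume at most `1/N`, where `M` bounds every squared distance from `Ω`. -/
lemma exists_balancedCells (hd : 0 < d) (hN : 0 < N) (hΩ : IsCompact Ω) (hvol : 1 ≤ volume Ω)
    (hX : Function.Injective X) :
    ∃ ψ : Fin N → ℝ, (∀ i, 0 ≤ ψ i) ∧ BalancedCells Ω X ψ := by
  suffices h : ∃ ψ : Fin N → ℝ, (∀ i, 0 ≤ ψ i) ∧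
      ∀ i, volume (truncatedCell Ω X ψ i) = (N : ℝ≥0∞)⁻¹ by
    obtain ⟨ψ, h0, h1⟩ := h
    exact ⟨ψ, h0, fun i => by rw [truncatedCell_eq (h0 i), h1 i]⟩
  obtain ⟨M, hM0, hM⟩ : ∃ M : ℝ, 0 ≤ M ∧ ∀ y ∈ Ω, ∀ i, ‖y - X i‖ ^ 2 ≤ M := by
    obtain ⟨M, hM⟩ := hΩ.bddAbove_image
      (f := fun y => ∑ i, ‖y - X i‖ ^ 2) (by fun_prop)
    refine ⟨max M 0, le_max_right _ _, fun y hy i => le_max_of_le_left ?_⟩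
    refine le_trans ?_ (hM ⟨y, hy, rfl⟩)
    exact Finset.single_le_sum (f := fun i => ‖y - X i‖ ^ 2) (fun _ _ => by positivity)
      (Finset.mem_univ i)
  let S : Set (Fin N → ℝ) := Set.Icc 0 (fun _ => M) ∩
    {ψ | ∀ i, volume (truncatedCell Ω X ψ i) ≤ (N : ℝ≥0∞)⁻¹}
  have hcont := continuous_measure_truncatedCell (N := N) hd hΩ hX
  have hS : IsCompact S := by
    refine isCompact_Icc.inter_right ?_
    simp only [Set.ofPred_forall]
    exact isClosed_iInter fun i => isClosed_le (hcont i) continuous_const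
  have hS0 : (0 : Fin N → ℝ) ∈ S := by
    refine ⟨⟨le_rfl, fun _ => hM0⟩, fun i => ?_⟩
    rw [measure_mono_null (fun y hy => ?_) (measure_sq_dist_eq_null hd (X i) 0)]
    · exact zero_le
    · exact le_antisymm hy.2.1 (by positivity)
  obtain ⟨ψ, hψS, hmax⟩ := hS.exists_isMaxOn ⟨0, hS0⟩
    (f := fun ψ : Fin N → ℝ => ∑ i, ψ i) (by fun_prop)
  obtain ⟨⟨hψ0, hψM⟩, hψN⟩ := hψS
  -- A weight below the cap can be raised as long as its own cell is too small: the other cells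
  -- only shrink.
  have key : ∀ i, ψ i < M → volume (truncatedCell Ω X ψ i) = (N : ℝ≥0∞)⁻¹ := by
    intro i hi
    by_contra hne
    have hlt := lt_of_le_of_ne (hψN i) hne
    have hc : Continuous fun t : ℝ => volume (truncatedCell Ω X (Function.update ψ i t) i) :=
      (hcont i).comp (by fun_prop)
    have e1 : ∀ᶠ t in 𝓝[>] (ψ i),
        volume (truncatedCell Ω X (Function.update ψ i t) i) < (N : ℝ≥0∞)⁻¹ := by
      refine (hc.continuousAt.eventually_lt continuousAt_const ?_).filter_mono nhdsWithin_le_nhds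
      simpa using hlt
    have e2 : ∀ᶠ t in 𝓝[>] (ψ i), t < M := (eventually_lt_nhds hi).filter_mono nhdsWithin_le_nhds
    obtain ⟨t, h1, h2, h3⟩ := (e1.and (e2.and self_mem_nhdsWithin)).exists
    have h3 : ψ i < t := h3
    have hmem : Function.update ψ i t ∈ S := by
      refine ⟨⟨fun j => ?_, fun j => ?_⟩, fun j => ?_⟩
      · rcases eq_or_ne j i with rfl | hj
        · simpa using (hψ0 j).trans h3.le
        · simpa [hj] using hψ0 j
      · rcases eq_or_ne j i with rfl | hj
        · simpa using h2.le
        · simpa [hj] using hψM j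
      · rcases eq_or_ne j i with rfl | hj
        · exact h1.le
        · exact (measure_mono (truncatedCell_update_subset hj h3.le)).trans (hψN j)
    have hle : ∑ j, Function.update ψ i t j ≤ ∑ j, ψ j := hmax hmem
    refine hle.not_gt (Finset.sum_lt_sum (fun j _ => ?_) ⟨i, Finset.mem_univ i, by simpa using h3⟩)
    rcases eq_or_ne j i with rfl | hj
    · simpa using h3.le
    · simp [hj]
  refine ⟨ψ, hψ0, ?_⟩
  by_cases hall : ∀ i, ψ i < M
  · exact fun i => key i (hall i)
  push Not at hall
  obtain ⟨k, hk⟩ := hall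
  -- One ball now covers `Ω`, so the volumes, each at most `1/N`, add up to at least `1`.
  have hcover : Ω ⊆ ⋃ i, truncatedCell Ω X ψ i := fun y hy =>
    mem_iUnion_truncatedCell hy ((hM y hy k).trans hk)
  have hsum : 1 ≤ ∑ i, volume (truncatedCell Ω X ψ i) :=
    hvol.trans ((measure_mono hcover).trans (measure_iUnion_fintype_le _ _))
  have hN' : (N : ℝ≥0∞) ≠ 0 := by exact_mod_cast hN.ne'
  have hone : ∑ _i : Fin N, (N : ℝ≥0∞)⁻¹ = 1 := by
    simp [ENNReal.mul_inv_cancel hN' (ENNReal.natCast_ne_top N)]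
  intro i
  by_contra hne
  have hlt := lt_of_le_of_ne (hψN i) hne
  have : ∑ i, volume (truncatedCell Ω X ψ i) < ∑ _i : Fin N, (N : ℝ≥0∞)⁻¹ := by
    rw [← Finset.add_sum_erase _ _ (Finset.mem_univ i),
      ← Finset.add_sum_erase _ _ (Finset.mem_univ i), add_comm, add_comm (N : ℝ≥0∞)⁻¹]
    refine ENNReal.add_lt_add_of_le_of_lt ?_ (Finset.sum_le_sum fun j _ => hψN j) hlt
    exact ENNReal.sum_ne_top.2 fun j _ => ((hψN j).trans_lt (by simpa using hN)).ne
  exact (hsum.trans_lt (this.trans_eq hone)).false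

/-! ### The potential and its sublevel set -/

lemma phi_nonpos (ψ : Fin N → ℝ) (y : EuclideanSpace ℝ (Fin d)) : phi X ψ y ≤ 0 := min_le_right _ _

lemma phi_le (ψ : Fin N → ℝ) (y : EuclideanSpace ℝ (Fin d)) (i : Fin N) :
    phi X ψ y ≤ ‖y - X i‖ ^ 2 - ψ i :=
  (min_le_left _ _).trans (ciInf_le (Set.finite_range _).bddBelow i)

lemma phi_eq_of_mem {ψ : Fin N → ℝ} {y : EuclideanSpace ℝ (Fin d)} {i : Fin N}
    (hy : y ∈ truncatedCell Ω X ψ i) : phi X ψ y = ‖y - X i‖ ^ 2 - ψ i := by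
  have : Nonempty (Fin N) := ⟨i⟩
  exact le_antisymm (phi_le ψ y i) (le_min (le_ciInf hy.2.2) (by have := hy.2.1; linarith))

lemma neg_sum_le_phi {ψ : Fin N → ℝ} (hψ : ∀ i, 0 ≤ ψ i) (y : EuclideanSpace ℝ (Fin d)) :
    -∑ i, ψ i ≤ phi X ψ y := by
  have hs : 0 ≤ ∑ i, ψ i := Finset.sum_nonneg fun i _ => hψ i
  refine le_min ?_ (by linarith)
  rcases isEmpty_or_nonempty (Fin N) with h | h
  · simp
  · refine le_ciInf fun i => ?_
    have := Finset.single_le_sum (fun i _ => hψ i) (Finset.mem_univ i)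
    have : 0 ≤ ‖y - X i‖ ^ 2 := by positivity
    linarith

lemma measurable_phi (ψ : Fin N → ℝ) : Measurable (phi X ψ) := by
  refine Measurable.min (Measurable.iInf fun i => ?_) measurable_const
  exact Continuous.measurable (by fun_prop)

lemma integrable_phi {ψ : Fin N → ℝ} (hψ : ∀ i, 0 ≤ ψ i)
    (ρ : Measure (EuclideanSpace ℝ (Fin d))) [IsFiniteMeasure ρ] : Integrable (phi X ψ) ρ := by
  refine Integrable.of_bound (measurable_phi ψ).aestronglyMeasurable (∑ i, ψ i)
    (ae_of_all _ fun y => ?_)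
  rw [Real.norm_eq_abs, abs_le]
  exact ⟨neg_sum_le_phi hψ y, (phi_nonpos ψ y).trans (Finset.sum_nonneg fun i _ => hψ i)⟩

/-- The congested region `{φ < 0} ∩ Ω`, on which `σ` equals `1`. -/
def congestedSet (Ω : Set (EuclideanSpace ℝ (Fin d))) (X : Fin N → EuclideanSpace ℝ (Fin d))
    (ψ : Fin N → ℝ) : Set (EuclideanSpace ℝ (Fin d)) :=
  {y | phi X ψ y < 0} ∩ Ω

lemma measurableSet_congestedSet (hΩ : IsCompact Ω) (ψ : Fin N → ℝ) :
    MeasurableSet (congestedSet Ω X ψ) :=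
  (measurableSet_lt (measurable_phi ψ) measurable_const).inter hΩ.measurableSet

lemma sigmaMeasure_eq_restrict (hΩ : IsCompact Ω) (ψ : Fin N → ℝ) :
    sigmaMeasure Ω X ψ = volume.restrict (congestedSet Ω X ψ) := by
  rw [sigmaMeasure, ← withDensity_indicator_one (measurableSet_congestedSet hΩ ψ)]
  congr 1
  ext y
  by_cases hy : y ∈ congestedSet Ω X ψ
  · have : y ∈ {y | phi X ψ y < 0} ∩ Ω := hy
    simp [sigma, hy, this]
  · have : y ∉ {y | phi X ψ y < 0} ∩ Ω := hy
    simp [sigma, hy, this]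

lemma congestedSet_ae_eq (hd : 0 < d) (hN : 0 < N) (ψ : Fin N → ℝ) :
    congestedSet Ω X ψ =ᵐ[volume] ⋃ i, truncatedCell Ω X ψ i := by
  have : Nonempty (Fin N) := ⟨⟨0, hN⟩⟩
  have h : ∀ᵐ y : EuclideanSpace ℝ (Fin d), ∀ i, ‖y - X i‖ ^ 2 ≠ ψ i := by
    rw [ae_all_iff]
    intro i
    rw [ae_iff]
    simpa using measure_sq_dist_eq_null hd (X i) (ψ i)
  rw [eventuallyEq_set]
  filter_upwards [h] with y hy
  constructor
  · rintro ⟨h1, h2⟩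
    have h1 : min (⨅ i, (‖y - X i‖ ^ 2 - ψ i)) 0 < 0 := h1
    rw [min_lt_iff, or_iff_left (lt_irrefl _)] at h1
    obtain ⟨j, hj⟩ := exists_lt_of_ciInf_lt h1
    exact mem_iUnion_truncatedCell h2 (j := j) (by linarith)
  · intro hy'
    obtain ⟨i, hi⟩ := Set.mem_iUnion.1 hy'
    refine ⟨?_, hi.1⟩
    show phi X ψ y < 0
    rw [phi_eq_of_mem hi, sub_neg]
    exact lt_of_le_of_ne hi.2.1 (hy i)

lemma sigmaMeasure_eq_sum (hd : 0 < d) (hN : 0 < N) (hΩ : IsCompact Ω)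
    (hX : Function.Injective X) (ψ : Fin N → ℝ) :
    sigmaMeasure Ω X ψ = ∑ i, volume.restrict (truncatedCell Ω X ψ i) := by
  rw [sigmaMeasure_eq_restrict hΩ, Measure.restrict_congr_set (congestedSet_ae_eq hd hN ψ),
    Measure.restrict_iUnion_ae (aedisjoint_truncatedCell hX ψ)
      (fun i => (isClosed_truncatedCell hΩ.isClosed ψ i).nullMeasurableSet), Measure.sum_fintype]

/-- `σ` is a probability density bounded by `1`: its mass is the sum of the `N` cell volumes. -/
lemma sigmaMeasure_mem_densityConstraint (hd : 0 < d) (hN : 0 < N) (hΩ : IsCompact Ω)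
    (hX : Function.Injective X) {ψ : Fin N → ℝ}
    (hbal : ∀ i, volume (truncatedCell Ω X ψ i) = (N : ℝ≥0∞)⁻¹) :
    sigmaMeasure Ω X ψ ∈ densityConstraint Ω := by
  have hm := measurableSet_congestedSet (X := X) hΩ ψ
  refine ⟨⟨⟨?_⟩, ?_, withDensity_absolutelyContinuous _ _⟩, ?_⟩
  · have hN' : (N : ℝ≥0∞) ≠ 0 := by exact_mod_cast hN.ne'
    rw [sigmaMeasure_eq_sum hd hN hΩ hX]
    simp [hbal, ENNReal.mul_inv_cancel hN' (ENNReal.natCast_ne_top N)]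
  · rw [sigmaMeasure_eq_restrict hΩ, Measure.restrict_apply hΩ.measurableSet.compl]
    refine measure_mono_null (t := ∅) ?_ measure_empty
    rintro y ⟨h1, -, h2⟩
    exact h1 h2
  · rw [sigmaMeasure_eq_restrict hΩ]
    filter_upwards [Measure.rnDeriv_restrict_self volume hm] with y hy
    rw [hy]
    exact Set.indicator_apply_le' (fun _ => le_rfl) (fun _ => zero_le)

/-! ### Kantorovich duality -/

instance isFiniteMeasure_empiricalMeasure [NeZero N] : IsFiniteMeasure (empiricalMeasure X) := by
  refine ⟨?_⟩
  have hN' : (N : ℝ≥0∞) ≠ 0 := by exact_mod_cast NeZero.ne N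
  simp [empiricalMeasure, ENNReal.inv_mul_cancel hN' (ENNReal.natCast_ne_top N)]

/-- Weak duality: an admissible pair bounds the cost of every transport plan from below. -/
lemma ofReal_dualValue_le_wassersteinSq (hN : 0 < N) (hX : Function.Injective X)
    {ρ : Measure (EuclideanSpace ℝ (Fin d))} (hρ : ρ Ωᶜ = 0)
    {f : EuclideanSpace ℝ (Fin d) → ℝ} {g : Fin N → ℝ} (h : IsAdmissiblePair Ω ρ X f g) :
    ENNReal.ofReal (dualValue ρ f g) ≤ wassersteinSq ρ (empiricalMeasure X) := by
  have : NeZero N := ⟨hN.ne'⟩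
  obtain ⟨hf, hfg⟩ := h
  refine le_iInf₂ fun π hπ => ?_
  obtain ⟨h1, h2⟩ := hπ
  -- The target potential, extended by zero off the points `x_i`.
  let G : EuclideanSpace ℝ (Fin d) → ℝ := fun y => ∑ i, ({X i} : Set _).indicator (fun _ => g i) y
  have hGX : ∀ i, G (X i) = g i := by
    intro i
    simp only [G]
    rw [Finset.sum_eq_single i]
    · simp
    · intro j _ hj
      have hne : X i ∉ ({X j} : Set (EuclideanSpace ℝ (Fin d))) := fun h => hj (hX h).symm
      rw [Set.indicator_of_notMem hne]
    · simp
  have hG : Measurable G := Finset.measurable_sum _ fun i _ =>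
    measurable_const.indicator (measurableSet_singleton _)
  have hGi : Integrable G (empiricalMeasure X) := integrable_finsetSum _ fun i _ =>
    (integrable_const _).indicator (measurableSet_singleton _)
  have hGint : ∫ y, G y ∂(empiricalMeasure X) = (∑ i, g i) / N := by
    rw [empiricalMeasure, integral_smul_measure,
      integral_finsetSum_measure (fun i _ => integrable_dirac (by simp))]
    simp [hGX, div_eq_inv_mul]
  have hf' : Integrable (fun p : EuclideanSpace ℝ (Fin d) × EuclideanSpace ℝ (Fin d) => f p.1) π :=
    Integrable.comp_measurable (g := f) (by rwa [h1]) measurable_fst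
  have hG' : Integrable (fun p : EuclideanSpace ℝ (Fin d) × EuclideanSpace ℝ (Fin d) => G p.2) π :=
    Integrable.comp_measurable (g := G) (by rwa [h2]) measurable_snd
  have hval : dualValue ρ f g = ∫ p, (f p.1 + G p.2) ∂π := by
    rw [integral_add hf' hG', dualValue, ← hGint, ← h1, ← h2,
      integral_map measurable_fst.aemeasurable (by rw [h1]; exact hf.1),
      integral_map measurable_snd.aemeasurable hG.aestronglyMeasurable]
  have a1 : ∀ᵐ p ∂π, p.1 ∈ Ω := by
    refine ae_of_ae_map (p := fun y => y ∈ Ω) measurable_fst.aemeasurable ?_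
    rw [h1]
    exact hρ
  have a2 : ∀ᵐ p ∂π, p.2 ∈ Set.range X := by
    refine ae_of_ae_map (p := fun y => y ∈ Set.range X) measurable_snd.aemeasurable ?_
    rw [h2, empiricalMeasure, ae_iff]
    simp [Measure.dirac_apply]
  have hsum : Integrable (fun p => f p.1 + G p.2) π := hf'.add hG'
  rw [hval]
  calc ENNReal.ofReal (∫ p, (f p.1 + G p.2) ∂π)
      ≤ ∫⁻ p, ENNReal.ofReal (f p.1 + G p.2) ∂π := by
        rw [integral_eq_lintegral_pos_part_sub_lintegral_neg_part hsum]
        refine (ENNReal.ofReal_le_ofReal (sub_le_self _ ENNReal.toReal_nonneg)).trans ?_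
        exact ENNReal.ofReal_toReal_le
    _ ≤ ∫⁻ p, ‖p.1 - p.2‖ₑ ^ 2 ∂π := by
        refine lintegral_mono_ae ?_
        filter_upwards [a1, a2] with p hp1 hp2
        obtain ⟨i, hi⟩ := hp2
        have := hfg p.1 hp1 i
        rw [← hi, hGX, ← ofReal_norm, ← ENNReal.ofReal_pow (norm_nonneg _)]
        exact ENNReal.ofReal_le_ofReal this

/-- The plan that sends each truncated cell to its centre. -/
noncomputable def cellPlan (Ω : Set (EuclideanSpace ℝ (Fin d))) (X : Fin N → EuclideanSpace ℝ (Fin d))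
    (ψ : Fin N → ℝ) : Measure (EuclideanSpace ℝ (Fin d) × EuclideanSpace ℝ (Fin d)) :=
  ∑ i, (volume.restrict (truncatedCell Ω X ψ i)).map fun y => (y, X i)

lemma cellPlan_mem_transportPlans (hd : 0 < d) (hN : 0 < N) (hΩ : IsCompact Ω)
    (hX : Function.Injective X) {ψ : Fin N → ℝ}
    (hbal : ∀ i, volume (truncatedCell Ω X ψ i) = (N : ℝ≥0∞)⁻¹) :
    cellPlan Ω X ψ ∈ transportPlans (sigmaMeasure Ω X ψ) (empiricalMeasure X) := by
  have hmeas : ∀ i, Measurable fun y : EuclideanSpace ℝ (Fin d) => (y, X i) := fun i => by fun_prop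
  constructor
  · rw [cellPlan, ← Measure.mapₗ_apply_of_measurable measurable_fst, map_sum,
      sigmaMeasure_eq_sum hd hN hΩ hX]
    refine Finset.sum_congr rfl fun i _ => ?_
    rw [Measure.mapₗ_apply_of_measurable measurable_fst, Measure.map_map measurable_fst (hmeas i)]
    exact Measure.map_id
  · rw [cellPlan, ← Measure.mapₗ_apply_of_measurable measurable_snd, map_sum, empiricalMeasure,
      Finset.smul_sum]
    refine Finset.sum_congr rfl fun i _ => ?_
    rw [Measure.mapₗ_apply_of_measurable measurable_snd, Measure.map_map measurable_snd (hmeas i)]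
    show Measure.map (fun _ => X i) _ = _
    rw [Measure.map_const, Measure.restrict_apply_univ, hbal]

/-- The cell plan has cost exactly the dual value of `(φ, ψ)`, because `φ + ψ_i = ‖· - x_i‖²` on
the `i`-th truncated cell. -/
lemma lintegral_cellPlan (hd : 0 < d) (hN : 0 < N) (hΩ : IsCompact Ω)
    (hX : Function.Injective X) {ψ : Fin N → ℝ} (hψ : ∀ i, 0 ≤ ψ i)
    (hbal : ∀ i, volume (truncatedCell Ω X ψ i) = (N : ℝ≥0∞)⁻¹) :
    0 ≤ dualValue (sigmaMeasure Ω X ψ) (phi X ψ) ψ ∧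
      ∫⁻ p, ‖p.1 - p.2‖ₑ ^ 2 ∂(cellPlan Ω X ψ)
        = ENNReal.ofReal (dualValue (sigmaMeasure Ω X ψ) (phi X ψ) ψ) := by
  have hfin : ∀ i, IsFiniteMeasure (volume.restrict (truncatedCell Ω X ψ i)) := fun i =>
    ⟨by rw [Measure.restrict_apply_univ, hbal]; simpa using hN⟩
  have hcm : ∀ i, MeasurableSet (truncatedCell Ω X ψ i) := fun i =>
    (isClosed_truncatedCell hΩ.isClosed ψ i).measurableSet
  have hcell : ∀ i, ∫ y in truncatedCell Ω X ψ i, ‖y - X i‖ ^ 2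
      = (∫ y in truncatedCell Ω X ψ i, phi X ψ y) + ψ i / N := by
    intro i
    have : ∫ y in truncatedCell Ω X ψ i, ‖y - X i‖ ^ 2
        = ∫ y in truncatedCell Ω X ψ i, (phi X ψ y + ψ i) := by
      refine setIntegral_congr_fun (hcm i) fun y hy => ?_
      simp only [phi_eq_of_mem hy]
      ring
    rw [this, integral_add (integrable_phi hψ _) (integrable_const _)]
    simp [Measure.real, hbal, div_eq_inv_mul]
  have hval : dualValue (sigmaMeasure Ω X ψ) (phi X ψ) ψ
      = ∑ i, ∫ y in truncatedCell Ω X ψ i, ‖y - X i‖ ^ 2 := by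
    rw [dualValue, sigmaMeasure_eq_sum hd hN hΩ hX,
      integral_finsetSum_measure (fun i _ => integrable_phi hψ _), Finset.sum_div,
      ← Finset.sum_add_distrib]
    exact Finset.sum_congr rfl fun i _ => (hcell i).symm
  have hnn : ∀ i, 0 ≤ ∫ y in truncatedCell Ω X ψ i, ‖y - X i‖ ^ 2 := fun i =>
    integral_nonneg fun y => by positivity
  refine ⟨hval ▸ Finset.sum_nonneg fun i _ => hnn i, ?_⟩
  rw [hval, ENNReal.ofReal_sum_of_nonneg fun i _ => hnn i, cellPlan, lintegral_finsetSum_measure]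
  refine Finset.sum_congr rfl fun i _ => ?_
  have hint : IntegrableOn (fun y => ‖y - X i‖ ^ 2) (truncatedCell Ω X ψ i) := by
    have : Continuous fun y : EuclideanSpace ℝ (Fin d) => ‖y - X i‖ ^ 2 := by fun_prop
    exact (this.continuousOn.integrableOn_compact hΩ).mono_set fun y hy => hy.1
  rw [ofReal_integral_eq_lintegral_ofReal hint (ae_of_all _ fun y => by positivity),
    lintegral_map (by fun_prop) (by fun_prop)]
  refine lintegral_congr fun y => ?_
  rw [← ofReal_norm, ← ENNReal.ofReal_pow (norm_nonneg _)]

lemma phi_admissible (ρ : Measure (EuclideanSpace ℝ (Fin d))) [IsFiniteMeasure ρ]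
    {ψ : Fin N → ℝ} (hψ : ∀ i, 0 ≤ ψ i) : IsAdmissiblePair Ω ρ X (phi X ψ) ψ :=
  ⟨integrable_phi hψ ρ, fun y _ i => by have := phi_le (X := X) ψ y i; linarith⟩

lemma wassersteinSq_sigmaMeasure (hd : 0 < d) (hN : 0 < N) (hΩ : IsCompact Ω)
    (hX : Function.Injective X) {ψ : Fin N → ℝ} (hψ : ∀ i, 0 ≤ ψ i)
    (hbal : ∀ i, volume (truncatedCell Ω X ψ i) = (N : ℝ≥0∞)⁻¹) :
    wassersteinSq (sigmaMeasure Ω X ψ) (empiricalMeasure X)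
      = ENNReal.ofReal (dualValue (sigmaMeasure Ω X ψ) (phi X ψ) ψ) := by
  have hσ := sigmaMeasure_mem_densityConstraint hd hN hΩ hX hbal
  have := hσ.1.1
  refine le_antisymm ?_
    (ofReal_dualValue_le_wassersteinSq hN hX hσ.1.2.1 (phi_admissible _ hψ))
  rw [← (lintegral_cellPlan hd hN hΩ hX hψ hbal).2]
  exact iInf₂_le _ (cellPlan_mem_transportPlans hd hN hΩ hX hbal)

/-! ### The bathtub principle -/

lemma integral_phi_eq_neg_toReal (ψ : Fin N → ℝ) (ρ : Measure (EuclideanSpace ℝ (Fin d))) :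
    ∫ y, phi X ψ y ∂ρ = -(∫⁻ y, ENNReal.ofReal (-phi X ψ y) ∂ρ).toReal := by
  rw [← integral_eq_lintegral_of_nonneg_ae
    (ae_of_all _ fun y => neg_nonneg.2 (phi_nonpos ψ y)) (measurable_phi ψ).neg.aestronglyMeasurable,
    integral_neg, neg_neg]

lemma lintegral_neg_phi_eq (hΩ : IsCompact Ω) {ψ : Fin N → ℝ}
    {ρ : Measure (EuclideanSpace ℝ (Fin d))} (hρ : ρ ∈ densityConstraint Ω) :
    ∫⁻ y, ENNReal.ofReal (-phi X ψ y) ∂ρ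
      = ∫⁻ y in congestedSet Ω X ψ, ρ.rnDeriv volume y * ENNReal.ofReal (-phi X ψ y) := by
  have := hρ.1.1
  have hm := measurableSet_congestedSet (X := X) hΩ ψ
  have hu : Measurable fun y => ENNReal.ofReal (-phi X ψ y) := (measurable_phi ψ).neg.ennreal_ofReal
  have hz : ∫⁻ y in (congestedSet Ω X ψ)ᶜ, ENNReal.ofReal (-phi X ψ y) ∂ρ = 0 := by
    rw [lintegral_eq_zero_iff hu, EventuallyEq, ae_restrict_iff' hm.compl]
    have hΩ' : ∀ᵐ y ∂ρ, y ∈ Ω := hρ.1.2.1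
    filter_upwards [hΩ'] with y hy hy'
    have : 0 ≤ phi X ψ y := not_lt.1 fun h => hy' ⟨h, hy⟩
    simpa using this
  rw [← lintegral_add_compl _ hm, hz, add_zero]
  rw [← setLIntegral_rnDeriv_mul hρ.1.2.2 hu.aemeasurable hm]

/-- Among densities bounded by `1`, the integral of `φ ≤ 0` is smallest for `σ`, which saturates
the set where `φ < 0`; any other density with the same integral also saturates it. -/
lemma integral_phi_sigmaMeasure_le (hΩ : IsCompact Ω) {ψ : Fin N → ℝ} (hψ : ∀ i, 0 ≤ ψ i)
    (hσ : sigmaMeasure Ω X ψ ∈ densityConstraint Ω)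
    {ρ : Measure (EuclideanSpace ℝ (Fin d))} (hρ : ρ ∈ densityConstraint Ω) :
    ∫ y, phi X ψ y ∂(sigmaMeasure Ω X ψ) ≤ ∫ y, phi X ψ y ∂ρ ∧
    (∫ y, phi X ψ y ∂ρ ≤ ∫ y, phi X ψ y ∂(sigmaMeasure Ω X ψ) → ρ = sigmaMeasure Ω X ψ) := by
  have := hρ.1.1
  have := hσ.1.1
  have hm := measurableSet_congestedSet (X := X) hΩ ψ
  have hu : Measurable fun y => ENNReal.ofReal (-phi X ψ y) := (measurable_phi ψ).neg.ennreal_ofReal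
  have hfin : ∀ τ : Measure (EuclideanSpace ℝ (Fin d)), IsFiniteMeasure τ →
      ∫⁻ y, ENNReal.ofReal (-phi X ψ y) ∂τ ≠ ∞ := fun τ _ =>
    ((integrable_phi hψ τ).neg.lintegral_lt_top).ne
  have hle : ∀ᵐ y ∂volume.restrict (congestedSet Ω X ψ),
      ρ.rnDeriv volume y * ENNReal.ofReal (-phi X ψ y) ≤ ENNReal.ofReal (-phi X ψ y) := by
    filter_upwards [ae_restrict_of_ae hρ.2] with y hy
    exact mul_le_of_le_one_left zero_le hy
  have hσe : ∫⁻ y, ENNReal.ofReal (-phi X ψ y) ∂(sigmaMeasure Ω X ψ)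
      = ∫⁻ y in congestedSet Ω X ψ, ENNReal.ofReal (-phi X ψ y) := by
    rw [sigmaMeasure_eq_restrict hΩ]
  have hρe := lintegral_neg_phi_eq (X := X) (ψ := ψ) hΩ hρ
  rw [integral_phi_eq_neg_toReal, integral_phi_eq_neg_toReal]
  constructor
  · rw [neg_le_neg_iff]
    refine ENNReal.toReal_mono (hfin _ inferInstance) ?_
    rw [hρe, hσe]
    exact lintegral_mono_ae hle
  · intro h
    rw [neg_le_neg_iff, ENNReal.toReal_le_toReal (hfin _ inferInstance) (hfin _ inferInstance),
      hσe, hρe] at h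
    have heq := ae_eq_of_ae_le_of_lintegral_le hle (hρe ▸ hfin ρ inferInstance) hu.aemeasurable h
    have hone : ∀ᵐ y ∂volume.restrict (congestedSet Ω X ψ), ρ.rnDeriv volume y = 1 := by
      filter_upwards [heq, ae_restrict_mem hm] with y hy hy'
      have hneg : phi X ψ y < 0 := hy'.1
      have h0 : ENNReal.ofReal (-phi X ψ y) ≠ 0 := by simpa using hneg
      exact (ENNReal.mul_eq_right h0 ENNReal.ofReal_ne_top).1 hy
    refine (Measure.eq_of_le_of_isProbabilityMeasure (Measure.le_iff.2 fun s hs => ?_)).symm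
    rw [sigmaMeasure_eq_restrict hΩ, Measure.restrict_apply hs]
    calc volume (s ∩ congestedSet Ω X ψ)
        = ∫⁻ y in s ∩ congestedSet Ω X ψ, ρ.rnDeriv volume y := by
          rw [lintegral_congr_ae (g := fun _ => 1), setLIntegral_one]
          exact ae_restrict_of_ae_restrict_of_subset Set.inter_subset_right hone
      _ = ρ (s ∩ congestedSet Ω X ψ) := Measure.setLIntegral_rnDeriv hρ.1.2.2 _
      _ ≤ ρ s := measure_mono Set.inter_subset_left

end

end CrowdMotion

theorem proposition5p2 (d N : ℕ) (hd : 0 < d) (hN : 0 < N)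
    (Ω : Set (EuclideanSpace ℝ (Fin d))) (hΩ : IsCompact Ω) (hvol : 1 ≤ volume Ω)
    (X : Fin N → EuclideanSpace ℝ (Fin d)) (hX : X ∉ CrowdMotion.collisionSet d N) :
    (∃ ψ : Fin N → ℝ, (∀ i, 0 ≤ ψ i) ∧ CrowdMotion.BalancedCells Ω X ψ) ∧
    ∀ ψ : Fin N → ℝ, (∀ i, 0 ≤ ψ i) → CrowdMotion.BalancedCells Ω X ψ →
      (∀ ρ : Measure (EuclideanSpace ℝ (Fin d)),
        CrowdMotion.IsWassersteinProjection (CrowdMotion.densityConstraint Ω)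
          (CrowdMotion.empiricalMeasure X) ρ ↔ ρ = CrowdMotion.sigmaMeasure Ω X ψ) ∧
      ((∀ y, CrowdMotion.phi X ψ y ≤ 0) ∧
        ∀ y ∈ Ω, CrowdMotion.phi X ψ y * (1 - CrowdMotion.sigma Ω X ψ y) = 0) ∧
      CrowdMotion.AreOptimalPotentials Ω (CrowdMotion.sigmaMeasure Ω X ψ) X
        (CrowdMotion.phi X ψ) ψ := by
  have hXi := injective_of_notMem_collisionSet hX
  refine ⟨exists_balancedCells hd hN hΩ hvol hXi, fun ψ hψ hbal' => ?_⟩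
  have hbal : ∀ i, volume (truncatedCell Ω X ψ i) = (N : ℝ≥0∞)⁻¹ := fun i => by
    rw [← truncatedCell_eq (hψ i), hbal' i]
  have hσ := sigmaMeasure_mem_densityConstraint hd hN hΩ hXi hbal
  have hW := wassersteinSq_sigmaMeasure hd hN hΩ hXi hψ hbal
  have hnn := (lintegral_cellPlan hd hN hΩ hXi hψ hbal).1
  have hlow : ∀ ρ ∈ densityConstraint Ω,
      ENNReal.ofReal (dualValue ρ (phi X ψ) ψ) ≤ wassersteinSq ρ (empiricalMeasure X) := by
    intro ρ hρ
    have := hρ.1.1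
    exact ofReal_dualValue_le_wassersteinSq hN hXi hρ.1.2.1 (phi_admissible ρ hψ)
  refine ⟨fun ρ => ⟨fun hρ => ?_, ?_⟩, ⟨phi_nonpos ψ, fun y hy => ?_⟩, ?_⟩
  · refine (integral_phi_sigmaMeasure_le hΩ hψ hσ hρ.1).2 ?_
    have h := (hlow ρ hρ.1).trans (hρ.2 _ hσ)
    rw [hW, ENNReal.ofReal_le_ofReal_iff hnn] at h
    exact le_of_add_le_add_right h
  · rintro rfl
    refine ⟨hσ, fun ρ hρ => ?_⟩
    rw [hW]
    refine (ENNReal.ofReal_le_ofReal ?_).trans (hlow ρ hρ)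
    exact add_le_add_left (integral_phi_sigmaMeasure_le hΩ hψ hσ hρ).1 _
  · rcases (phi_nonpos (X := X) ψ y).lt_or_eq with h | h
    · have : y ∈ {y | phi X ψ y < 0} ∩ Ω := ⟨h, hy⟩
      simp [sigma, this]
    · simp [h]
  · have := hσ.1.1
    have hfin : wassersteinSq (sigmaMeasure Ω X ψ) (empiricalMeasure X) ≠ ∞ := by
      rw [hW]
      exact ENNReal.ofReal_ne_top
    have hval : dualValue (sigmaMeasure Ω X ψ) (phi X ψ) ψ
        = (wassersteinSq (sigmaMeasure Ω X ψ) (empiricalMeasure X)).toReal := by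
      rw [hW, ENNReal.toReal_ofReal hnn]
    refine ⟨phi_admissible _ hψ, fun f g hfg => ?_, hfin, hval⟩
    rw [hval]
    exact (ENNReal.ofReal_le_iff_le_toReal hfin).1
      (ofReal_dualValue_le_wassersteinSq hN hXi hσ.1.2.1 hfg)
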